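/- Let $\mathcal{M}$ be a (real or complex) unital Banach algebra, let $A \in \mathcal{M}$, and let $\{A_{i,n} : 1 \le i \le n,\ n \in \mathbb{N}\} \subseteq \mathcal{M}$ be a uniformly bounded triangular array such that $\frac1n \sum_{i=1}^n A_{i,n} \to A$ in norm. Let $(c_n)$ be a sequence of positive integers with $c_n = o(n/\log n)$. Suppose that for each $n$ there are elements $B_{1,n}, \dots, B_{c_n,n} \in \mathcal{M}$ and an assignment $j_n : \{1,\dots,n\} \to \{1,\dots,c_n\}$ such that $$\frac1n \sum_{i=1}^n \| A_{i,n} - B_{j_n(i),n} \| \to 0 \qquad (n \to \infty).$$ For each $n$ let $\sigma_n$ be a uniformly distributed random permutation in $S(n)$, all the $\sigma_n$ being defined on a common probability space, with arbitrary joint distribution. Then, almost surely, the permuted products (factors in increasing order of $i$ from left to right) converge uniformly on $[0,1]$: $$\sup_{0 \le t \le 1} \Bigl\| \prod_{i=1}^{\lfloor tn \rfloor} e^{A_{\sigma_n(i),n}/n} - e^{tA} \Bigr\| \to 0 \qquad (n \to \infty).$$ In particular, $\mathbb{P}\bigl( \bigl\| \prod_{i=1}^{\lfloor tn \rfloor}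 e^{A_{\sigma_n(i),n}/n} - e^{tA} \bigr\| \to 0 \text{ for all } 0 \le t \le 1 \bigr) = 1$. -/

import Mathlib

open Filter MeasureTheory Asymptotics
open scoped Topology ENNReal Nat

/-- `σ : Ω → S(n)` is a uniformly distributed random permutation of `n` objects: each event
`{σ = π}` is measurable and has probability `1 / n!`. -/
def IsUniformRandomPerm {Ω : Type*} [MeasurableSpace Ω] (μ : Measure Ω) {n : ℕ}
    (σ : Ω → Equiv.Perm (Fin n)) : Prop :=
  ∀ π : Equiv.Perm (Fin n),
    MeasurableSet (σ ⁻¹' {π}) ∧ μ (σ ⁻¹' {π}) = ((n ! : ℕ) : ℝ≥0∞)⁻¹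

/-- The permuted product of exponentials
`e^{a_{π(1)}/n} e^{a_{π(2)}/n} ⋯ e^{a_{π([tn])}/n}` (in this order, with at most `n` factors),
for a row `a` of length `n` and a permutation `π` of its indices. -/
noncomputable def permutedExpProd {M : Type*} [NormedRing M] [NormedAlgebra ℝ M] {n : ℕ}
    (a : Fin n → M) (π : Equiv.Perm (Fin n)) (t : ℝ) : M :=
  ((List.ofFn fun i : Fin n => NormedSpace.exp ((n : ℝ)⁻¹ • a (π i))).take ⌊t * n⌋₊).prod

/-- The probability that the random subset of `α` which contains each point independently with
probability `p` is equal to `R`. -/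
noncomputable def bernoulliWeight {α : Type*} [Fintype α] [DecidableEq α] (p : ℝ)
    (R : Finset α) : ℝ :=
  p ^ R.card * (1 - p) ^ Rᶜ.card

/-- The deviation of the indicator of `R` from the constant `p`. -/
noncomputable def indicatorDeviation {α : Type*} [DecidableEq α] (p : ℝ) (R : Finset α) (i : α) :
    ℝ :=
  (if i ∈ R then 1 else 0) - p

/-- The total deviation of the numbers of points of `R` in the fibres of `j` from `p` times the
sizes of the fibres. -/
noncomputable def discrepancy {α γ : Type*} [Fintype α] [DecidableEq α] [Fintype γ]
    [DecidableEq γ] (j : α → γ) (p : ℝ) (R : Finset α) : ℝ :=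
  ∑ c, |∑ i with j i = c, indicatorDeviation p R i|

lemma bernoulliWeight_nonneg {α : Type*} [Fintype α] [DecidableEq α] {p : ℝ} (hp0 : 0 ≤ p)
    (hp1 : p ≤ 1) (R : Finset α) : 0 ≤ bernoulliWeight p R :=
  mul_nonneg (pow_nonneg hp0 _) (pow_nonneg (by linarith) _)

lemma two_point_exp_moment_le {p u : ℝ} (hp0 : 0 ≤ p) (hp1 : p ≤ 1) (hu : |u| ≤ 1) :
    p * Real.exp (u * (1 - p)) + (1 - p) * Real.exp (u * (0 - p)) ≤ Real.exp (u ^ 2) := by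
  have key : ∀ x : ℝ, |x| ≤ 1 → Real.exp x ≤ 1 + x + x ^ 2 := fun x hx => by
    have := (abs_le.mp (Real.abs_exp_sub_one_sub_id_le hx)).2
    linarith
  have h1 : |u * (1 - p)| ≤ 1 := by
    rw [abs_mul, abs_of_nonneg (by linarith : 0 ≤ 1 - p)]
    nlinarith [abs_nonneg u]
  have h2 : |u * (0 - p)| ≤ 1 := by
    rw [abs_mul, zero_sub, abs_neg, abs_of_nonneg hp0]
    nlinarith [abs_nonneg u]
  have h3 := mul_le_mul_of_nonneg_left (key _ h1) hp0
  have h4 := mul_le_mul_of_nonneg_left (key _ h2) (by linarith : 0 ≤ 1 - p)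
  have h5 := Real.add_one_le_exp (u ^ 2)
  have h6 : 0 ≤ u ^ 2 * (1 - p * (1 - p)) := mul_nonneg (sq_nonneg _) (by nlinarith)
  nlinarith

lemma sum_bernoulliWeight_mul_exp_le {α : Type*} [Fintype α] [DecidableEq α] {p l : ℝ}
    (hp0 : 0 ≤ p) (hp1 : p ≤ 1) (hl0 : 0 ≤ l) (hl1 : l ≤ 1) (s : α → ℝ) (hs : ∀ i, |s i| ≤ 1) :
    ∑ R : Finset α, bernoulliWeight p R * Real.exp (l * ∑ i, s i * indicatorDeviation p R i)
      ≤ Real.exp (l ^ 2 * Fintype.card α) := by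
  have h1 : ∀ R : Finset α,
      bernoulliWeight p R * Real.exp (l * ∑ i, s i * indicatorDeviation p R i)
        = (∏ i ∈ R, p * Real.exp (l * s i * (1 - p)))
          * ∏ i ∈ Rᶜ, (1 - p) * Real.exp (l * s i * (0 - p)) := fun R => by
    rw [Finset.prod_mul_distrib, Finset.prod_mul_distrib, Finset.prod_const, Finset.prod_const,
      ← Real.exp_sum, ← Real.exp_sum, bernoulliWeight, mul_mul_mul_comm, ← Real.exp_add,
      Finset.mul_sum, ← Finset.sum_add_sum_compl R]
    congr 3 <;> refine Finset.sum_congr rfl fun i hi => ?_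
    · simp [indicatorDeviation, hi, mul_assoc]
    · simp [indicatorDeviation, Finset.mem_compl.mp hi, mul_assoc]
  rw [Finset.sum_congr rfl fun R _ => h1 R, ← Fintype.prod_add, mul_comm, ← nsmul_eq_mul,
    Real.exp_nsmul, ← Finset.card_univ, ← Finset.prod_const]
  refine Finset.prod_le_prod (fun i _ => ?_) fun i _ => ?_
  · exact add_nonneg (mul_nonneg hp0 (Real.exp_pos _).le)
      (mul_nonneg (by linarith) (Real.exp_pos _).le)
  · have hu : |l * s i| ≤ l := by
      rw [abs_mul, abs_of_nonneg hl0]; nlinarith [hs i]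
    refine (two_point_exp_moment_le hp0 hp1 (hu.trans hl1)).trans (Real.exp_le_exp.mpr ?_)
    rw [← sq_abs]
    exact pow_le_pow_left₀ (abs_nonneg _) hu 2

lemma exp_mul_abs_le {l x : ℝ} : Real.exp (l * |x|) ≤ Real.exp (l * x) + Real.exp (l * -x) := by
  rcases abs_choice x with h | h <;> rw [h] <;>
    linarith [Real.exp_pos (l * x), Real.exp_pos (l * -x)]

lemma sum_bernoulliWeight_mul_exp_discrepancy_le {α γ : Type*} [Fintype α] [DecidableEq α]
    [Fintype γ] [DecidableEq γ] (j : α → γ) {p l : ℝ}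
    (hp0 : 0 ≤ p) (hp1 : p ≤ 1) (hl0 : 0 ≤ l) (hl1 : l ≤ 1) :
    ∑ R : Finset α, bernoulliWeight p R * Real.exp (l * discrepancy j p R)
      ≤ 2 ^ Fintype.card γ * Real.exp (l ^ 2 * Fintype.card α) := by
  have h1 : ∀ R : Finset α, Real.exp (l * discrepancy j p R)
      ≤ ∑ t : Finset γ, Real.exp (l * ∑ i, (if j i ∈ t then 1 else -1)
          * indicatorDeviation p R i) := fun R => by
    rw [discrepancy, Finset.mul_sum, Real.exp_sum]
    refine (Finset.prod_le_prod (fun c _ => (Real.exp_pos _).le)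
      fun c _ => exp_mul_abs_le).trans ?_
    rw [Fintype.prod_add]
    refine (Finset.sum_congr rfl fun t _ => ?_).le
    rw [← Real.exp_sum, ← Real.exp_sum, ← Real.exp_add, ← Finset.mul_sum, ← Finset.mul_sum,
      ← mul_add]
    congr 2
    rw [← Finset.sum_fiberwise (s := Finset.univ) (g := j), ← Finset.sum_add_sum_compl t]
    congr 1 <;> refine Finset.sum_congr rfl fun c hc => ?_
    · refine Finset.sum_congr rfl fun i hi => ?_
      simp [(Finset.mem_filter.mp hi).2, hc]
    · rw [← Finset.sum_neg_distrib]
      refine Finset.sum_congr rfl fun i hi => ?_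
      simp [(Finset.mem_filter.mp hi).2, Finset.mem_compl.mp hc]
  calc _ ≤ ∑ R : Finset α, bernoulliWeight p R * ∑ t : Finset γ,
        Real.exp (l * ∑ i, (if j i ∈ t then 1 else -1) * indicatorDeviation p R i) :=
        Finset.sum_le_sum fun R _ =>
          mul_le_mul_of_nonneg_left (h1 R) (bernoulliWeight_nonneg hp0 hp1 R)
    _ = ∑ t : Finset γ, ∑ R : Finset α, bernoulliWeight p R *
        Real.exp (l * ∑ i, (if j i ∈ t then 1 else -1) * indicatorDeviation p R i) := by
        simp_rw [Finset.mul_sum]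
        exact Finset.sum_comm
    _ ≤ ∑ t : Finset γ, Real.exp (l ^ 2 * Fintype.card α) :=
        Finset.sum_le_sum fun t _ => sum_bernoulliWeight_mul_exp_le hp0 hp1 hl0 hl1 _
          fun i => by split_ifs <;> simp
    _ = _ := by simp

lemma binomial_term_le_mode {n k m : ℕ} (hk : k ≤ n) (hm : m ≤ n) :
    ((k / n : ℝ) ^ m * (1 - k / n) ^ (n - m) * n.choose m : ℝ)
      ≤ (k / n) ^ k * (1 - k / n) ^ (n - k) * n.choose k := by
  rcases Nat.eq_zero_or_pos n with rfl | hn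
  · obtain rfl : k = 0 := by omega
    obtain rfl : m = 0 := by omega
    rfl
  have hn' : (0 : ℝ) < n := by exact_mod_cast hn
  set p : ℝ := k / n with hp
  have hpn : p * n = k := by rw [hp]; field_simp
  have hkn : (k : ℝ) ≤ n := by exact_mod_cast hk
  have hp0 : 0 ≤ p := by positivity
  have hp1 : p ≤ 1 := by rw [hp, div_le_one hn']; exact hkn
  set f : ℕ → ℝ := fun m => p ^ m * (1 - p) ^ (n - m) * n.choose m with hf
  have f_nonneg : ∀ m, 0 ≤ f m := fun m =>
    mul_nonneg (mul_nonneg (pow_nonneg hp0 _) (pow_nonneg (by linarith) _)) (by positivity)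
  have step : ∀ m < n, f (m + 1) * ((m + 1) * (1 - p)) = f m * ((n - m) * p) := fun m hm => by
    have h1 : ((n.choose (m + 1) : ℕ) : ℝ) * (m + 1) = n.choose m * (n - m) := by
      have := Nat.choose_succ_right_eq n m
      rw [← Nat.cast_sub hm.le]
      exact_mod_cast this
    have h2 : n - m = (n - (m + 1)) + 1 := by omega
    simp only [hf]
    rw [h2, pow_succ, pow_succ]
    linear_combination (p ^ m * p * (1 - p) ^ (n - (m + 1)) * (1 - p)) * h1
  have up : ∀ m < k, f m ≤ f (m + 1) := fun m hm => by
    have hmk : (m : ℝ) + 1 ≤ k := by exact_mod_cast hm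
    have hpos : 0 < (n - m) * p := mul_pos (by linarith) (by
      rw [hp]; exact div_pos (by linarith [(Nat.cast_nonneg m : (0:ℝ) ≤ m)]) hn')
    have hle : (m + 1) * (1 - p) ≤ (n - m) * p := by
      refine le_of_mul_le_mul_right ?_ hn'
      nlinarith
    refine le_of_mul_le_mul_right ?_ hpos
    rw [← step m (by omega)]
    exact mul_le_mul_of_nonneg_left hle (f_nonneg _)
  have down : ∀ m, k ≤ m → m < n → f (m + 1) ≤ f m := fun m hkm hm => by
    have hmk : (k : ℝ) ≤ m := by exact_mod_cast hkm
    have hmn : (m : ℝ) + 1 ≤ n := by exact_mod_cast hm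
    have hpos : 0 < (m + 1) * (1 - p) := mul_pos (by positivity) (by
      rw [hp, sub_pos, div_lt_one hn']; linarith)
    have hle : (n - m) * p ≤ (m + 1) * (1 - p) := by
      refine le_of_mul_le_mul_right ?_ hn'
      nlinarith
    refine le_of_mul_le_mul_right ?_ hpos
    rw [step m hm]
    exact mul_le_mul_of_nonneg_left hle (f_nonneg _)
  change f m ≤ f k
  rcases le_total m k with h | h
  · exact Nat.decreasingInduction' (P := fun i => f i ≤ f k)
      (fun i hi _ ih => (up i hi).trans ih) h le_rfl
  · have : ∀ i, k ≤ i → i ≤ n → f i ≤ f k := fun i hi => by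
      induction i, hi using Nat.le_induction with
      | base => exact fun _ => le_rfl
      | succ i hi ih => exact fun h => (down i hi h).trans (ih (by omega))
    exact this m h hm

lemma one_le_binomial_mode {n k : ℕ} (hk : k ≤ n) :
    (1 : ℝ) ≤ (n + 1) * ((k / n) ^ k * (1 - k / n) ^ (n - k) * n.choose k) := by
  have h := add_pow (k / n : ℝ) (1 - k / n) n
  rw [add_sub_cancel, one_pow] at h
  refine h.le.trans ((Finset.sum_le_card_nsmul _ _ _ fun m hm =>
    binomial_term_le_mode hk (Nat.lt_succ_iff.mp (Finset.mem_range.mp hm))).trans ?_)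
  simp

lemma exists_perm_map_eq {α : Type*} [Fintype α] [DecidableEq α] {R S : Finset α}
    (h : R.card = S.card) : ∃ τ : Equiv.Perm α, R.map τ.toEmbedding = S := by
  have e : {x // x ∈ R} ≃ {x // x ∈ S} := Finset.equivOfCardEq h
  refine ⟨e.extendSubtype, Finset.eq_of_subset_of_card_le (fun x hx => ?_) (by simp [h])⟩
  obtain ⟨y, hy, rfl⟩ := Finset.mem_map.mp hx
  exact e.extendSubtype_mem y hy

/-- The average of a nonnegative function over a uniformly random set of size `k` is at most
`n + 1` times its average over a Bernoulli random set of density `k / n`, where `n` is the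
cardinality of the type. -/
lemma sum_perm_map_le {α : Type*} [Fintype α] [DecidableEq α] (R₀ : Finset α)
    (F : Finset α → ℝ) (hF : ∀ R, 0 ≤ F R) :
    ∑ π : Equiv.Perm α, F (R₀.map π.toEmbedding) ≤ (Fintype.card α)! * ((Fintype.card α + 1)
      * ∑ R : Finset α, bernoulliWeight (R₀.card / Fintype.card α) R * F R) := by
  set n := Fintype.card α with hn
  set k := R₀.card with hk
  have hkn : k ≤ n := Finset.card_le_univ R₀
  set p : ℝ := k / n with hp
  have hp0 : 0 ≤ p := by positivity
  have hp1 : p ≤ 1 := div_le_one_of_le₀ (by exact_mod_cast hkn) (by positivity)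
  set S := ∑ π : Equiv.Perm α, F (R₀.map π.toEmbedding) with hS
  have hS0 : 0 ≤ S := Finset.sum_nonneg fun _ _ => hF _
  have orbit : ∀ R : Finset α, R.card = k →
      ∑ π : Equiv.Perm α, F (R.map π.toEmbedding) = S := fun R hR => by
    obtain ⟨τ, rfl⟩ := exists_perm_map_eq (R := R₀) (S := R) hR.symm
    rw [hS]
    refine Fintype.sum_equiv (Equiv.mulRight τ) _ _ fun π => ?_
    rw [Finset.map_map]
    rfl
  have reindex : ∀ π : Equiv.Perm α, ∑ R : Finset α, bernoulliWeight p R * F R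
      = ∑ R : Finset α, bernoulliWeight p R * F (R.map π.toEmbedding) := fun π => by
    refine (Fintype.sum_equiv (Equiv.finsetCongr π) _ _ fun R => ?_).symm
    simp [bernoulliWeight, Finset.card_compl]
  have h1 : (n ! : ℝ) * ∑ R : Finset α, bernoulliWeight p R * F R
      = ∑ R : Finset α, bernoulliWeight p R *
        ∑ π : Equiv.Perm α, F (R.map π.toEmbedding) := by
    have : ∑ _π : Equiv.Perm α, ∑ R : Finset α, bernoulliWeight p R * F R
        = (n ! : ℝ) * ∑ R : Finset α, bernoulliWeight p R * F R := by
      rw [Finset.sum_const, Finset.card_univ, Fintype.card_perm, nsmul_eq_mul]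
    rw [← this, Finset.sum_congr rfl fun π _ => reindex π, Finset.sum_comm]
    simp_rw [Finset.mul_sum]
  have h2 : (p ^ k * (1 - p) ^ (n - k) * n.choose k) * S ≤
      ∑ R : Finset α, bernoulliWeight p R * ∑ π : Equiv.Perm α, F (R.map π.toEmbedding) := by
    calc _ = ∑ R ∈ Finset.powersetCard k Finset.univ, bernoulliWeight p R *
          ∑ π : Equiv.Perm α, F (R.map π.toEmbedding) := by
          rw [Finset.sum_congr rfl (g := fun _ => p ^ k * (1 - p) ^ (n - k) * S),
            Finset.sum_const, Finset.card_powersetCard, Finset.card_univ, nsmul_eq_mul]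
          · ring
          · intro R hR
            have hR := (Finset.mem_powersetCard.mp hR).2
            rw [orbit R hR, bernoulliWeight, Finset.card_compl, hR]
      _ ≤ _ := Finset.sum_le_univ_sum_of_nonneg fun R =>
          mul_nonneg (bernoulliWeight_nonneg hp0 hp1 R) (Finset.sum_nonneg fun _ _ => hF _)
  calc S = 1 * S := (one_mul S).symm
    _ ≤ ((n + 1) * (p ^ k * (1 - p) ^ (n - k) * n.choose k)) * S :=
        mul_le_mul_of_nonneg_right (one_le_binomial_mode hkn) hS0
    _ = (n + 1) * ((p ^ k * (1 - p) ^ (n - k) * n.choose k) * S) := by ring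
    _ ≤ (n + 1) * (n ! * ∑ R : Finset α, bernoulliWeight p R * F R) := by
        rw [h1]; exact mul_le_mul_of_nonneg_left h2 (by positivity)
    _ = _ := by ring

/-- Exponential bound for the number of permutations that move a given set to a set with a large
discrepancy. -/
lemma card_discrepancy_gt_le {α γ : Type*} [Fintype α] [DecidableEq α]
    [Fintype γ] [DecidableEq γ] (j : α → γ) (R₀ : Finset α) {δ : ℝ} (hδ0 : 0 ≤ δ) (hδ1 : δ ≤ 1) :
    (Finset.card {π : Equiv.Perm α | δ * Fintype.card α
        < discrepancy j (R₀.card / Fintype.card α) (R₀.map π.toEmbedding)} : ℝ)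
      ≤ (Fintype.card α)! * ((Fintype.card α + 1) *
        (2 ^ Fintype.card γ * Real.exp (-(δ ^ 2 / 4) * Fintype.card α))) := by
  set n := Fintype.card α with hn
  set p : ℝ := R₀.card / n with hp
  have hp0 : 0 ≤ p := by positivity
  have hp1 : p ≤ 1 :=
    div_le_one_of_le₀ (by exact_mod_cast Finset.card_le_univ R₀) (by positivity)
  set F : Finset α → ℝ := fun R => Real.exp (δ / 2 * discrepancy j p R) with hF
  have h1 : (Finset.card {π : Equiv.Perm α | δ * n < discrepancy j p (R₀.map π.toEmbedding)} : ℝ)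
      * Real.exp (δ / 2 * (δ * n)) ≤ ∑ π : Equiv.Perm α, F (R₀.map π.toEmbedding) := by
    rw [← nsmul_eq_mul]
    refine (Finset.card_nsmul_le_sum _ (fun π : Equiv.Perm α => F (R₀.map π.toEmbedding)) _
      fun π hπ => ?_).trans (Finset.sum_le_univ_sum_of_nonneg fun _ => (Real.exp_pos _).le)
    exact Real.exp_le_exp.mpr
      (mul_le_mul_of_nonneg_left (Finset.mem_filter.mp hπ).2.le (by linarith))
  have h2 := h1.trans (sum_perm_map_le R₀ F fun _ => (Real.exp_pos _).le)
  have h3 := sum_bernoulliWeight_mul_exp_discrepancy_le j hp0 hp1 (by linarith : 0 ≤ δ / 2)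
    (by linarith)
  have h4 : Real.exp (-(δ ^ 2 / 4) * n) =
      Real.exp ((δ / 2) ^ 2 * n) / Real.exp (δ / 2 * (δ * n)) := by
    rw [← Real.exp_sub]; congr 1; ring
  rw [h4, ← mul_div_assoc, ← mul_div_assoc, ← mul_div_assoc, le_div_iff₀ (Real.exp_pos _)]
  refine h2.trans ?_
  gcongr

/-- The set of the first `k` elements of `Fin n`. -/
def finPrefix (n k : ℕ) : Finset (Fin n) := {i | (i : ℕ) < k}

lemma card_finPrefix {n k : ℕ} (hk : k ≤ n) : (finPrefix n k).card = k := by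
  simp [finPrefix, Fin.card_filter_val_lt, hk]

lemma IsUniformRandomPerm.measure_mem_le {Ω : Type*} [MeasurableSpace Ω] {μ : Measure Ω} {n : ℕ}
    {σ : Ω → Equiv.Perm (Fin n)} (hσ : IsUniformRandomPerm μ σ)
    (S : Finset (Equiv.Perm (Fin n))) {x : ℝ} (hS : (S.card : ℝ) ≤ n ! * x) :
    μ {ω | σ ω ∈ S} ≤ ENNReal.ofReal x := by
  have h1 : {ω | σ ω ∈ S} = ⋃ π ∈ S, σ ⁻¹' {π} := by ext ω; simp
  have hn : (0 : ℝ) < n ! := by exact_mod_cast Nat.factorial_pos n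
  calc μ {ω | σ ω ∈ S} ≤ ∑ π ∈ S, μ (σ ⁻¹' {π}) := h1 ▸ measure_biUnion_finset_le S _
    _ = S.card * ((n ! : ℕ) : ℝ≥0∞)⁻¹ := by
        rw [Finset.sum_congr rfl fun π _ => (hσ π).2, Finset.sum_const, nsmul_eq_mul]
    _ = ENNReal.ofReal (S.card / n !) := by
        rw [ENNReal.ofReal_div_of_pos hn, ENNReal.ofReal_natCast, ENNReal.ofReal_natCast,
          ENNReal.div_eq_inv_mul, mul_comm]
    _ ≤ _ := ENNReal.ofReal_le_ofReal (by rw [div_le_iff₀ hn]; linarith)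

lemma eventually_natCast_le_mul_of_isLittleO {c : ℕ → ℕ}
    (hc : (fun n : ℕ => (c n : ℝ)) =o[atTop] fun n : ℕ => (n : ℝ) / Real.log n)
    {ε : ℝ} (hε : 0 < ε) : ∀ᶠ n : ℕ in atTop, (c n : ℝ) ≤ ε * n := by
  filter_upwards [hc.bound hε,
    (Real.tendsto_log_atTop.comp tendsto_natCast_atTop_atTop).eventually_ge_atTop 1] with n h1 h2
  rw [Real.norm_of_nonneg (Nat.cast_nonneg _)] at h1
  refine h1.trans (mul_le_mul_of_nonneg_left ?_ hε.le)
  simp only [Function.comp_apply] at h2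
  rw [Real.norm_of_nonneg (div_nonneg (Nat.cast_nonneg _) (by linarith))]
  exact div_le_self (Nat.cast_nonneg _) h2

lemma summable_sq_mul_two_pow_mul_exp {c : ℕ → ℕ}
    (hc : ∀ ε : ℝ, 0 < ε → ∀ᶠ n : ℕ in atTop, (c n : ℝ) ≤ ε * n) {r : ℝ} (hr : 0 < r) :
    Summable fun n : ℕ => ((n : ℝ) + 1) * ((n + 1) * (2 ^ c n * Real.exp (-r * n))) := by
  have h1 := (Real.summable_pow_mul_exp_neg_nat_mul 2 (half_pos hr)).mul_left 4
  refine h1.of_norm_bounded_eventually_nat ?_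
  filter_upwards [hc _ (half_pos hr), eventually_ge_atTop 1] with n hn h1n
  have hn1 : (1 : ℝ) ≤ n := by exact_mod_cast h1n
  rw [Real.norm_of_nonneg (by positivity)]
  have h2 : (2 : ℝ) ^ c n * Real.exp (-r * n) ≤ Real.exp (-(r / 2) * n) := by
    have : (2 : ℝ) ^ c n ≤ Real.exp (c n) := by
      rw [← mul_one (c n : ℝ), Real.exp_nat_mul]
      exact pow_le_pow_left₀ (by norm_num) (by linarith [Real.add_one_le_exp 1]) _
    calc _ ≤ Real.exp (c n) * Real.exp (-r * n) := by gcongr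
      _ = Real.exp (c n + -r * n) := (Real.exp_add _ _).symm
      _ ≤ _ := Real.exp_le_exp.mpr (by linarith)
  calc _ ≤ (n + n : ℝ) * ((n + n) * Real.exp (-(r / 2) * n)) := by gcongr
    _ = _ := by ring

/-- Almost surely, all prefixes of the random permutations have a discrepancy of order `o(n)`. -/
lemma ae_eventually_discrepancy_le {c : ℕ → ℕ}
    (hc : ∀ ε : ℝ, 0 < ε → ∀ᶠ n : ℕ in atTop, (c n : ℝ) ≤ ε * n)
    (j : (n : ℕ) → Fin n → Fin (c n))
    {Ω : Type*} [MeasurableSpace Ω] {μ : Measure Ω}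
    {σ : (n : ℕ) → Ω → Equiv.Perm (Fin n)}
    (hσ : ∀ n : ℕ, IsUniformRandomPerm μ (σ n)) {δ : ℝ} (hδ0 : 0 < δ) (hδ1 : δ ≤ 1) :
    ∀ᵐ ω ∂μ, ∀ᶠ n : ℕ in atTop, ∀ k ≤ n,
      discrepancy (j n) (k / n) ((finPrefix n k).map (σ n ω).toEmbedding) ≤ δ * n := by
  set g : ℕ → ℝ := fun n => (n + 1) * (2 ^ c n * Real.exp (-(δ ^ 2 / 4) * n)) with hg
  have hg0 : ∀ n, 0 ≤ g n := fun n => by positivity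
  have hsum : Summable fun n : ℕ => ((n : ℝ) + 1) * g n :=
    summable_sq_mul_two_pow_mul_exp hc (by positivity)
  set s : ℕ → Set Ω := fun n => {ω | ∃ k ≤ n, δ * n <
    discrepancy (j n) (k / n) ((finPrefix n k).map (σ n ω).toEmbedding)} with hs
  have hμ : ∀ n, μ (s n) ≤ ENNReal.ofReal ((n + 1) * g n) := fun n => by
    set S : ℕ → Finset (Equiv.Perm (Fin n)) := fun k => {π | δ * n <
      discrepancy (j n) (k / n) ((finPrefix n k).map π.toEmbedding)} with hS
    have h1 : s n ⊆ ⋃ k ∈ Finset.range (n + 1), {ω | σ n ω ∈ S k} := by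
      rintro ω ⟨k, hk, h⟩
      simp only [Set.mem_iUnion, Finset.mem_range]
      exact ⟨k, by omega, by simpa [hS] using h⟩
    have h2 : ∀ k ∈ Finset.range (n + 1), μ {ω | σ n ω ∈ S k} ≤ ENNReal.ofReal (g n) := by
      intro k hk
      refine (hσ n).measure_mem_le _ ?_
      have := card_discrepancy_gt_le (j n) (finPrefix n k) hδ0.le hδ1
      rw [card_finPrefix (by simpa [Nat.lt_succ_iff] using hk), Fintype.card_fin,
        Fintype.card_fin] at this
      exact this
    calc μ (s n) ≤ ∑ k ∈ Finset.range (n + 1), μ {ω | σ n ω ∈ S k} :=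
          (measure_mono h1).trans (measure_biUnion_finset_le _ _)
      _ ≤ ∑ k ∈ Finset.range (n + 1), ENNReal.ofReal (g n) := Finset.sum_le_sum h2
      _ = _ := by
          rw [← ENNReal.ofReal_sum_of_nonneg fun _ _ => hg0 n, Finset.sum_const,
            Finset.card_range, nsmul_eq_mul]
          push_cast; rfl
  have hfin : ∑' n, μ (s n) ≠ ∞ :=
    ne_top_of_le_ne_top hsum.tsum_ofReal_ne_top (ENNReal.tsum_le_tsum hμ)
  filter_upwards [ae_eventually_notMem hfin] with ω hω
  filter_upwards [hω] with n hn k hk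
  by_contra h
  exact hn ⟨k, hk, not_le.mp h⟩

lemma exists_norm_le_forall_norm_sub_le {M ι : Type*} [NormedAddCommGroup M] [Fintype ι]
    {K : ℝ} (hK : 0 ≤ K) (x : ι → M) (hx : ∀ i, ‖x i‖ ≤ K) (s : Finset ι) (y : M) :
    ∃ z : M, ‖z‖ ≤ K ∧ ∀ i ∈ s, ‖x i - z‖ ≤ 2 * ‖x i - y‖ := by
  rcases s.eq_empty_or_nonempty with rfl | hs
  · exact ⟨0, by simpa using hK, by simp⟩
  · obtain ⟨l, -, hmin⟩ := s.exists_min_image (fun i => ‖x i - y‖) hs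
    refine ⟨x l, hx l, fun i hi => ?_⟩
    have h1 := norm_sub_le_norm_sub_add_norm_sub (x i) y (x l)
    rw [norm_sub_rev y] at h1
    linarith [hmin i hi]

lemma abs_indicatorDeviation_le {α : Type*} [DecidableEq α] {p : ℝ} (hp0 : 0 ≤ p) (hp1 : p ≤ 1)
    (R : Finset α) (i : α) : |indicatorDeviation p R i| ≤ 1 := by
  rw [indicatorDeviation, abs_le]
  split_ifs <;> constructor <;> linarith

lemma norm_sum_indicatorDeviation_smul_le {M α γ : Type*} [NormedAddCommGroup M]
    [NormedSpace ℝ M] [Fintype α] [DecidableEq α] [Fintype γ] [DecidableEq γ] {K : ℝ}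
    (hK : 0 ≤ K) (x : α → M) (hx : ∀ i, ‖x i‖ ≤ K) (b : γ → M) (j : α → γ) {p : ℝ}
    (hp0 : 0 ≤ p) (hp1 : p ≤ 1) (R : Finset α) :
    ‖∑ i, indicatorDeviation p R i • x i‖
      ≤ 2 * ∑ i, ‖x i - b (j i)‖ + K * discrepancy j p R := by
  choose z hz hxz using fun c =>
    exists_norm_le_forall_norm_sub_le hK x hx ({i | j i = c} : Finset α) (b c)
  have h1 : ∑ i, indicatorDeviation p R i • x i
      = ∑ i, indicatorDeviation p R i • (x i - z (j i))
        + ∑ c, (∑ i with j i = c, indicatorDeviation p R i) • z c := by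
    have : ∑ c, (∑ i with j i = c, indicatorDeviation p R i) • z c
        = ∑ i, indicatorDeviation p R i • z (j i) := by
      rw [← Finset.sum_fiberwise (s := Finset.univ) (g := j)]
      refine Finset.sum_congr rfl fun c _ => ?_
      rw [Finset.sum_smul]
      exact Finset.sum_congr rfl fun i hi => by rw [(Finset.mem_filter.mp hi).2]
    rw [this, ← Finset.sum_add_distrib]
    exact Finset.sum_congr rfl fun i _ => by rw [← smul_add, sub_add_cancel]
  rw [h1, Finset.mul_sum, discrepancy, Finset.mul_sum]
  refine (norm_add_le _ _).trans (add_le_add ((norm_sum_le _ _).trans ?_)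
    ((norm_sum_le _ _).trans ?_)) <;> refine Finset.sum_le_sum fun i _ => ?_
  · rw [norm_smul, Real.norm_eq_abs]
    have := hxz (j i) i (by simp)
    exact (mul_le_of_le_one_left (norm_nonneg _) (abs_indicatorDeviation_le hp0 hp1 R i)).trans
      this
  · rw [norm_smul, Real.norm_eq_abs, mul_comm]
    exact mul_le_mul_of_nonneg_right (hz i) (abs_nonneg _)

/-- The centred partial sums of a permuted row are controlled by the average of the row, the
approximation by the values `b` and the discrepancy of the prefix. -/
lemma norm_sum_finPrefix_sub_le {M γ : Type*} [NormedAddCommGroup M]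
    [NormedSpace ℝ M] [Fintype γ] [DecidableEq γ] {K : ℝ} (hK : 0 ≤ K) {n k : ℕ} (hk : k ≤ n)
    (x : Fin n → M) (hx : ∀ i, ‖x i‖ ≤ K) (A : M) (b : γ → M) (j : Fin n → γ)
    (π : Equiv.Perm (Fin n)) :
    ‖∑ i ∈ finPrefix n k, ((n : ℝ)⁻¹ • x (π i) - (n : ℝ)⁻¹ • A)‖
      ≤ ‖(n : ℝ)⁻¹ • ∑ i, x i - A‖ + 2 * ((n : ℝ)⁻¹ * ∑ i, ‖x i - b (j i)‖)
        + K * ((n : ℝ)⁻¹ * discrepancy j (k / n) ((finPrefix n k).map π.toEmbedding)) := by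
  rcases Nat.eq_zero_or_pos n with rfl | hn
  · obtain rfl : k = 0 := by omega
    simp [finPrefix, discrepancy]
  have hn' : (0 : ℝ) < n := by exact_mod_cast hn
  set p : ℝ := k / n with hp
  have hp0 : 0 ≤ p := by positivity
  have hp1 : p ≤ 1 := div_le_one_of_le₀ (by exact_mod_cast hk) hn'.le
  set R := (finPrefix n k).map π.toEmbedding with hR
  have h1 : ∑ i ∈ finPrefix n k, x (π i) = ∑ i, indicatorDeviation p R i • x i
      + p • ∑ i, x i := by
    have : ∑ i ∈ finPrefix n k, x (π i) = ∑ i ∈ R, x i := by rw [hR, Finset.sum_map]; rfl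
    rw [this, Finset.smul_sum, ← Finset.sum_add_distrib,
      ← Finset.univ_inter R, ← Finset.sum_ite_mem]
    refine Finset.sum_congr rfl fun i _ => ?_
    rw [Finset.univ_inter, ← add_smul, indicatorDeviation, sub_add_cancel, ite_smul, one_smul,
      zero_smul]
  have h2 : ∑ i ∈ finPrefix n k, ((n : ℝ)⁻¹ • x (π i) - (n : ℝ)⁻¹ • A)
      = p • ((n : ℝ)⁻¹ • ∑ i, x i - A)
        + (n : ℝ)⁻¹ • ∑ i, indicatorDeviation p R i • x i := by
    rw [Finset.sum_sub_distrib, ← Finset.smul_sum, h1, Finset.sum_const, card_finPrefix hk,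
      ← Nat.cast_smul_eq_nsmul ℝ, smul_smul, ← div_eq_mul_inv, ← hp, smul_add, smul_sub,
      smul_comm p]
    abel
  have h3 := norm_sum_indicatorDeviation_smul_le hK x hx b j hp0 hp1 R
  have h4 := mul_le_mul_of_nonneg_left h3 (inv_nonneg.mpr hn'.le)
  rw [h2]
  refine (norm_add_le _ _).trans ?_
  rw [norm_smul, norm_smul, Real.norm_of_nonneg hp0, Real.norm_of_nonneg (inv_nonneg.mpr hn'.le)]
  have h5 := mul_le_of_le_one_left (norm_nonneg ((n : ℝ)⁻¹ • ∑ i, x i - A)) hp1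
  linarith

section ExpEstimates

variable {M : Type*} [NormedRing M] [NormedAlgebra ℝ M] [CompleteSpace M]

lemma norm_exp_sub_one_sub_le (x : M) :
    ‖NormedSpace.exp x - 1 - x‖ ≤ Real.exp ‖x‖ - 1 - ‖x‖ := by
  have h1 := (hasSum_nat_add_iff' 2).mpr (NormedSpace.exp_series_hasSum_exp' (𝕂 := ℝ) x)
  have h2 := (hasSum_nat_add_iff' 2).mpr (NormedSpace.exp_series_hasSum_exp' (𝕂 := ℝ) ‖x‖)
  rw [← Real.exp_eq_exp_ℝ] at h2
  have h3 := h1.norm_le_of_bounded h2 fun i => by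
    rw [norm_smul, Real.norm_of_nonneg (by positivity), smul_eq_mul]
    exact mul_le_mul_of_nonneg_left (norm_pow_le' x (by omega)) (by positivity)
  simpa [Finset.sum_range_succ, sub_sub] using h3

lemma norm_exp_sub_one_sub_le_of_norm_le {x : M} {h : ℝ} (hx : ‖x‖ ≤ h) :
    ‖NormedSpace.exp x - 1 - x‖ ≤ h ^ 2 * Real.exp h := by
  have h0 := norm_nonneg x
  have key : Real.exp ‖x‖ - 1 ≤ ‖x‖ * Real.exp ‖x‖ := by
    have h1 := Real.add_one_le_exp (-‖x‖)
    have h2 := mul_le_mul_of_nonneg_right h1 (Real.exp_pos ‖x‖).le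
    rw [← Real.exp_add, neg_add_cancel, Real.exp_zero] at h2
    linarith
  calc _ ≤ Real.exp ‖x‖ - 1 - ‖x‖ := norm_exp_sub_one_sub_le x
    _ ≤ ‖x‖ * (Real.exp ‖x‖ - 1) := by linarith
    _ ≤ ‖x‖ * (‖x‖ * Real.exp ‖x‖) := mul_le_mul_of_nonneg_left key h0
    _ = ‖x‖ ^ 2 * Real.exp ‖x‖ := by ring
    _ ≤ _ := by gcongr

lemma norm_exp_sub_one_le_exp_norm_sub_one (x : M) :
    ‖NormedSpace.exp x - 1‖ ≤ Real.exp ‖x‖ - 1 := by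
  have h1 := norm_add_le (NormedSpace.exp x - 1 - x) x
  rw [sub_add_cancel] at h1
  linarith [norm_exp_sub_one_sub_le x]

lemma norm_exp_sub_one_le_of_norm_le {x : M} {h : ℝ} (hx : ‖x‖ ≤ h) :
    ‖NormedSpace.exp x - 1‖ ≤ h * Real.exp h := by
  have h1 := Real.add_one_le_exp (-h)
  have h2 := mul_le_mul_of_nonneg_right h1 (Real.exp_pos h).le
  rw [← Real.exp_add, neg_add_cancel, Real.exp_zero] at h2
  linarith [norm_exp_sub_one_le_exp_norm_sub_one x, Real.exp_le_exp.mpr hx]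

lemma norm_mul_exp_le {x : M} {h : ℝ} (hx : ‖x‖ ≤ h) (P : M) :
    ‖P * NormedSpace.exp x‖ ≤ ‖P‖ * Real.exp h := by
  have h1 : P * NormedSpace.exp x = P + P * (NormedSpace.exp x - 1) := by noncomm_ring
  have h2 := norm_exp_sub_one_le_exp_norm_sub_one x
  have h3 := Real.exp_le_exp.mpr hx
  rw [h1]
  calc _ ≤ ‖P‖ + ‖P‖ * (Real.exp h - 1) :=
        (norm_add_le _ _).trans (by gcongr; exact (norm_mul_le _ _).trans (by gcongr; linarith))
    _ = _ := by ring

lemma norm_exp_le_norm_one_mul {x : M} {h : ℝ} (hx : ‖x‖ ≤ h) :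
    ‖NormedSpace.exp x‖ ≤ ‖(1 : M)‖ * Real.exp h := by
  simpa using norm_mul_exp_le hx 1

lemma norm_prod_exp_le {P y : ℕ → M} {m : ℕ} {h : ℝ} (hP0 : P 0 = 1)
    (hP : ∀ i < m, P (i + 1) = P i * NormedSpace.exp (y i)) (hy : ∀ i < m, ‖y i‖ ≤ h) :
    ∀ i ≤ m, ‖P i‖ ≤ ‖(1 : M)‖ * Real.exp (i * h)
  | 0, _ => by simp [hP0]
  | i + 1, hi => by
    have ih := norm_prod_exp_le hP0 hP hy i (by omega)
    rw [hP i hi]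
    refine (norm_mul_exp_le (hy i hi) _).trans ?_
    calc _ ≤ ‖(1 : M)‖ * Real.exp (i * h) * Real.exp h := by gcongr
      _ = _ := by rw [mul_assoc, ← Real.exp_add]; push_cast; ring_nf

lemma norm_exp_mul_one_sub_sub_le {y B T T' : M} {h ε : ℝ} (hy : ‖y‖ ≤ h) (hB : ‖B‖ ≤ h)
    (hT : ‖T‖ ≤ ε) (hT' : ‖T'‖ ≤ ε) (hTT' : T' = T + (y - B)) :
    ‖NormedSpace.exp y * (1 - T') - (1 - T) * NormedSpace.exp B‖
      ≤ 2 * (h * Real.exp h) * (h + ε) := by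
  have hh : 0 ≤ h := (norm_nonneg y).trans hy
  have h1 : NormedSpace.exp y * (1 - T') - (1 - T) * NormedSpace.exp B
      = (NormedSpace.exp y - 1 - y) - (NormedSpace.exp B - 1 - B)
        - (NormedSpace.exp y - 1) * T' + T * (NormedSpace.exp B - 1) := by
    rw [hTT']; noncomm_ring
  have h2 : ‖(NormedSpace.exp y - 1) * T'‖ ≤ h * Real.exp h * ε :=
    (norm_mul_le _ _).trans (mul_le_mul (norm_exp_sub_one_le_of_norm_le hy) hT' (norm_nonneg _)
      (by positivity))
  have h3 : ‖T * (NormedSpace.exp B - 1)‖ ≤ ε * (h * Real.exp h) :=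
    (norm_mul_le _ _).trans (mul_le_mul hT (norm_exp_sub_one_le_of_norm_le hB) (norm_nonneg _)
      ((norm_nonneg T).trans hT))
  have h4 := norm_exp_sub_one_sub_le_of_norm_le hy
  have h5 := norm_exp_sub_one_sub_le_of_norm_le hB
  rw [h1]
  have h6 := norm_add_le (NormedSpace.exp y - 1 - y - (NormedSpace.exp B - 1 - B)
        - (NormedSpace.exp y - 1) * T') (T * (NormedSpace.exp B - 1))
  have h7 := norm_sub_le (NormedSpace.exp y - 1 - y - (NormedSpace.exp B - 1 - B))
    ((NormedSpace.exp y - 1) * T')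
  have h8 := norm_sub_le (NormedSpace.exp y - 1 - y) (NormedSpace.exp B - 1 - B)
  linarith

/-- If the partial sums of `y i - B` are small, the product of the exponentials of `y i` is close
to a power of the exponential of `B`. -/
lemma norm_prod_exp_sub_exp_pow_le {P y T : ℕ → M} {B : M} {m : ℕ} {h ε K : ℝ}
    (hP0 : P 0 = 1) (hP : ∀ i < m, P (i + 1) = P i * NormedSpace.exp (y i))
    (hT0 : T 0 = 0) (hT : ∀ i < m, T (i + 1) = T i + (y i - B))
    (hy : ∀ i < m, ‖y i‖ ≤ h) (hB : ‖B‖ ≤ h) (hε : ∀ i ≤ m, ‖T i‖ ≤ ε) (hm : m * h ≤ K) :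
    ‖P m - NormedSpace.exp B ^ m‖ ≤ ‖(1 : M)‖ * Real.exp K * ε
      + 2 * ‖(1 : M)‖ ^ 2 * K * Real.exp K * Real.exp h * (h + ε) := by
  have hh : 0 ≤ h := (norm_nonneg B).trans hB
  have hε0 : 0 ≤ ε := (norm_nonneg _).trans (hε 0 (Nat.zero_le _))
  have hQ := norm_prod_exp_le (P := fun i => NormedSpace.exp B ^ i) (y := fun _ => B) (m := m)
    (pow_zero _) (fun i _ => pow_succ _ _) (fun _ _ => hB)
  have hPn := norm_prod_exp_le hP0 hP hy
  set C := ‖(1 : M)‖ ^ 2 * Real.exp K * (2 * (h * Real.exp h) * (h + ε)) with hC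
  have main : ∀ i ≤ m, ‖P i * (1 - T i) * NormedSpace.exp B ^ (m - i) - NormedSpace.exp B ^ m‖
      ≤ i * C := by
    intro i
    induction i with
    | zero => simp [hP0, hT0]
    | succ i ih =>
      intro hi
      have e1 : m - i = (m - (i + 1)) + 1 := by omega
      have e2 : P (i + 1) * (1 - T (i + 1)) * NormedSpace.exp B ^ (m - (i + 1))
          - NormedSpace.exp B ^ m
          = P i * (NormedSpace.exp (y i) * (1 - T (i + 1)) - (1 - T i) * NormedSpace.exp B)
              * NormedSpace.exp B ^ (m - (i + 1))
            + (P i * (1 - T i) * NormedSpace.exp B ^ (m - i) - NormedSpace.exp B ^ m) := by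
        rw [e1, pow_succ', hP i hi]; noncomm_ring
      have e3 := norm_exp_mul_one_sub_sub_le (hy i hi) hB (hε i (by omega)) (hε (i + 1) hi)
        (hT i hi)
      have e4 : Real.exp (i * h) * Real.exp ((m - (i + 1) : ℕ) * h) ≤ Real.exp K := by
        rw [← Real.exp_add, ← add_mul]
        refine Real.exp_le_exp.mpr (le_trans (mul_le_mul_of_nonneg_right ?_ hh) hm)
        have : i + (m - (i + 1)) ≤ m := by omega
        exact_mod_cast this
      have e5 : ‖P i * (NormedSpace.exp (y i) * (1 - T (i + 1)) - (1 - T i) * NormedSpace.exp B)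
              * NormedSpace.exp B ^ (m - (i + 1))‖ ≤ C := by
        calc _ ≤ (‖(1 : M)‖ * Real.exp (i * h)) * (2 * (h * Real.exp h) * (h + ε))
              * (‖(1 : M)‖ * Real.exp ((m - (i + 1) : ℕ) * h)) := by
              refine (norm_mul_le _ _).trans (mul_le_mul ((norm_mul_le _ _).trans
                (mul_le_mul (hPn i (by omega)) e3 (norm_nonneg _) (by positivity)))
                (hQ _ (by omega)) (norm_nonneg _) (by positivity))
          _ = (‖(1 : M)‖ ^ 2 * (2 * (h * Real.exp h) * (h + ε)))
              * (Real.exp (i * h) * Real.exp ((m - (i + 1) : ℕ) * h)) := by ring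
          _ ≤ (‖(1 : M)‖ ^ 2 * (2 * (h * Real.exp h) * (h + ε))) * Real.exp K := by gcongr
          _ = C := by rw [hC]; ring
      rw [e2]
      push_cast
      linarith [norm_add_le (P i * (NormedSpace.exp (y i) * (1 - T (i + 1))
        - (1 - T i) * NormedSpace.exp B) * NormedSpace.exp B ^ (m - (i + 1)))
        (P i * (1 - T i) * NormedSpace.exp B ^ (m - i) - NormedSpace.exp B ^ m), ih (by omega)]
  have h1 := main m le_rfl
  rw [Nat.sub_self, pow_zero, mul_one] at h1
  have h2 : P m - NormedSpace.exp B ^ m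
      = P m * T m + (P m * (1 - T m) - NormedSpace.exp B ^ m) := by noncomm_ring
  have h3 : ‖P m * T m‖ ≤ ‖(1 : M)‖ * Real.exp K * ε := by
    refine (norm_mul_le _ _).trans (mul_le_mul ((hPn m le_rfl).trans ?_) (hε m le_rfl)
      (norm_nonneg _) (by positivity))
    gcongr
  have h4 : m * C ≤ 2 * ‖(1 : M)‖ ^ 2 * K * Real.exp K * Real.exp h * (h + ε) := by
    calc m * C = 2 * ‖(1 : M)‖ ^ 2 * (m * h) * Real.exp K * Real.exp h * (h + ε) := by
          rw [hC]; ring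
      _ ≤ _ := by gcongr
  rw [h2]
  linarith [norm_add_le (P m * T m) (P m * (1 - T m) - NormedSpace.exp B ^ m)]

lemma norm_exp_smul_sub_exp_smul_le (A : M) {s t h : ℝ} (hs0 : 0 ≤ s) (hs1 : s ≤ 1)
    (hst : s ≤ t) (hts : t ≤ s + h) :
    ‖NormedSpace.exp (s • A) - NormedSpace.exp (t • A)‖
      ≤ ‖(1 : M)‖ * Real.exp ‖A‖ * (h * ‖A‖ * Real.exp (h * ‖A‖)) := by
  let : NormedAlgebra ℚ M := NormedAlgebra.restrictScalars ℚ ℝ M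
  have h1 : NormedSpace.exp (t • A)
      = NormedSpace.exp (s • A) * NormedSpace.exp ((t - s) • A) := by
    rw [← NormedSpace.exp_add_of_commute (((Commute.refl A).smul_left _).smul_right _),
      ← add_smul, add_sub_cancel]
  have h2 : ‖s • A‖ ≤ ‖A‖ := by
    rw [norm_smul, Real.norm_of_nonneg hs0]
    exact mul_le_of_le_one_left (norm_nonneg _) hs1
  have h3 : ‖(t - s) • A‖ ≤ h * ‖A‖ := by
    rw [norm_smul, Real.norm_of_nonneg (by linarith)]
    exact mul_le_mul_of_nonneg_right (by linarith) (norm_nonneg _)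
  have h4 : NormedSpace.exp (s • A) - NormedSpace.exp (t • A)
      = -(NormedSpace.exp (s • A) * (NormedSpace.exp ((t - s) • A) - 1)) := by
    rw [h1]; noncomm_ring
  rw [h4, norm_neg]
  exact (norm_mul_le _ _).trans (mul_le_mul (norm_exp_le_norm_one_mul h2)
    (norm_exp_sub_one_le_of_norm_le h3) (norm_nonneg _) (by positivity))

/-- The distance of a permuted product of exponentials to `exp (t • A)` is controlled by the
centred partial sums of the permuted row. -/
lemma norm_exp_smul_sub_permutedExpProd_le {n : ℕ} (hn : 0 < n) {K ε t : ℝ} (x : Fin n → M)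
    (hx : ∀ i, ‖x i‖ ≤ K) {A : M} (hA : ‖A‖ ≤ K) (π : Equiv.Perm (Fin n))
    (hε : ∀ k ≤ n, ‖∑ i ∈ finPrefix n k, ((n : ℝ)⁻¹ • x (π i) - (n : ℝ)⁻¹ • A)‖ ≤ ε)
    (ht0 : 0 ≤ t) (ht1 : t ≤ 1) :
    ‖NormedSpace.exp (t • A) - permutedExpProd x π t‖ ≤
      (‖(1 : M)‖ * Real.exp K * ε
        + 2 * ‖(1 : M)‖ ^ 2 * K * Real.exp K * Real.exp K * ((n : ℝ)⁻¹ * K + ε))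
      + ‖(1 : M)‖ * Real.exp ‖A‖ * ((n : ℝ)⁻¹ * ‖A‖ * Real.exp ((n : ℝ)⁻¹ * ‖A‖)) := by
  have hn' : (0 : ℝ) < n := by exact_mod_cast hn
  have hK : 0 ≤ K := (norm_nonneg A).trans hA
  have hε0 : 0 ≤ ε := (norm_nonneg _).trans (hε 0 (Nat.zero_le _))
  set m := ⌊t * n⌋₊ with hm
  have htn : 0 ≤ t * n := by positivity
  have hmt : (m : ℝ) ≤ t * n := Nat.floor_le htn
  have htm : t * n < m + 1 := Nat.lt_floor_add_one _
  have hmn : m ≤ n := by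
    have : (m : ℝ) ≤ n := hmt.trans (mul_le_of_le_one_left hn'.le ht1)
    exact_mod_cast this
  set l : List M := List.ofFn fun i : Fin n => NormedSpace.exp ((n : ℝ)⁻¹ • x (π i)) with hl
  set y : ℕ → M := fun i => if h : i < n then (n : ℝ)⁻¹ • x (π ⟨i, h⟩) else 0 with hy
  set B : M := (n : ℝ)⁻¹ • A with hB
  have hP : ∀ i < m, (l.take (i + 1)).prod = (l.take i).prod * NormedSpace.exp (y i) := by
    intro i hi
    have hi' : i < n := by omega
    rw [List.prod_take_succ l i (by simpa [hl] using hi')]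
    simp [hl, hy, hi']
  have hT : ∀ i < m, ∑ r ∈ finPrefix n (i + 1), ((n : ℝ)⁻¹ • x (π r) - B)
      = ∑ r ∈ finPrefix n i, ((n : ℝ)⁻¹ • x (π r) - B) + (y i - B) := by
    intro i hi
    have hi' : i < n := by omega
    have : finPrefix n (i + 1) = insert ⟨i, hi'⟩ (finPrefix n i) := by
      ext r
      simp [finPrefix, Fin.ext_iff]
      omega
    rw [this, Finset.sum_insert (by simp [finPrefix]), add_comm]
    simp [hy, hi']
  have scale : ∀ z : M, ‖z‖ ≤ K → ‖(n : ℝ)⁻¹ • z‖ ≤ (n : ℝ)⁻¹ * K := fun z hz => by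
    rw [norm_smul, Real.norm_of_nonneg (by positivity)]
    gcongr
  have h1 := norm_prod_exp_sub_exp_pow_le (P := fun i => (l.take i).prod) (y := y)
    (T := fun i => ∑ r ∈ finPrefix n i, ((n : ℝ)⁻¹ • x (π r) - B)) (B := B) (m := m)
    (h := (n : ℝ)⁻¹ * K) (ε := ε) (K := K) (by simp) hP (by simp [finPrefix]) hT
    (fun i hi => by
      have hi' : i < n := by omega
      simpa [hy, hi'] using scale _ (hx (π ⟨i, hi'⟩)))
    (scale A hA) (fun i hi => hε i (hi.trans hmn)) (by
      rw [← mul_assoc]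
      refine mul_le_of_le_one_left hK ?_
      rw [← div_eq_mul_inv, div_le_one hn']
      exact_mod_cast hmn)
  have h2 : NormedSpace.exp B ^ m = NormedSpace.exp ((m / n : ℝ) • A) := by
    let : NormedAlgebra ℚ M := NormedAlgebra.restrictScalars ℚ ℝ M
    rw [← NormedSpace.exp_nsmul, ← Nat.cast_smul_eq_nsmul ℝ, hB, smul_smul, div_eq_mul_inv]
  have h3 := norm_exp_smul_sub_exp_smul_le A (s := m / n) (t := t) (h := (n : ℝ)⁻¹)
    (by positivity) ((div_le_one hn').mpr (by exact_mod_cast hmn))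
    ((div_le_iff₀ hn').mpr hmt) (by
      rw [← one_div, ← add_div, le_div_iff₀ hn']; exact htm.le)
  have h4 : Real.exp ((n : ℝ)⁻¹ * K) ≤ Real.exp K :=
    Real.exp_le_exp.mpr (mul_le_of_le_one_left hK (inv_le_one_of_one_le₀ (by exact_mod_cast hn)))
  have h5 : 2 * ‖(1 : M)‖ ^ 2 * K * Real.exp K * Real.exp ((n : ℝ)⁻¹ * K) * ((n : ℝ)⁻¹ * K + ε)
      ≤ 2 * ‖(1 : M)‖ ^ 2 * K * Real.exp K * Real.exp K * ((n : ℝ)⁻¹ * K + ε) := by gcongr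
  have h6 := norm_sub_le_norm_sub_add_norm_sub ((l.take m).prod) (NormedSpace.exp B ^ m)
    (NormedSpace.exp (t • A))
  rw [norm_sub_rev]
  change ‖(l.take m).prod - _‖ ≤ _
  rw [← h2] at h3
  linarith

end ExpEstimates

theorem theorem1 {M : Type*} [NormedRing M] [NormedAlgebra ℝ M] [CompleteSpace M]
    (A : M) (a : (n : ℕ) → Fin n → M)
    (ha_bdd : ∃ K : ℝ, ∀ (n : ℕ) (i : Fin n), ‖a n i‖ ≤ K)
    (ha_avg : Tendsto (fun n : ℕ => (n : ℝ)⁻¹ • ∑ i : Fin n, a n i) atTop (𝓝 A))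
    (c : ℕ → ℕ) (hc_pos : ∀ n : ℕ, 1 ≤ n → 0 < c n)
    (hc : (fun n : ℕ => (c n : ℝ)) =o[atTop] fun n : ℕ => (n : ℝ) / Real.log n)
    (b : (n : ℕ) → Fin (c n) → M) (j : (n : ℕ) → Fin n → Fin (c n))
    (hb : Tendsto (fun n : ℕ => (n : ℝ)⁻¹ * ∑ i : Fin n, ‖a n i - b n (j n i)‖) atTop (𝓝 0))
    {Ω : Type*} [MeasurableSpace Ω] (μ : Measure Ω) [IsProbabilityMeasure μ]
    (σ : (n : ℕ) → Ω → Equiv.Perm (Fin n))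
    (hσ : ∀ n : ℕ, IsUniformRandomPerm μ (σ n)) :
    ∀ᵐ ω ∂μ, TendstoUniformlyOn
      (fun (n : ℕ) (t : ℝ) => permutedExpProd (a n) (σ n ω) t)
      (fun t : ℝ => NormedSpace.exp (t • A)) atTop (Set.Icc 0 1) := by
  obtain ⟨K₀, hK₀⟩ := ha_bdd
  set K := max K₀ ‖A‖ with hK
  have haK : ∀ n i, ‖a n i‖ ≤ K := fun n i => (hK₀ n i).trans (le_max_left _ _)
  have hAK : ‖A‖ ≤ K := le_max_right _ _
  have hK0 : 0 ≤ K := (norm_nonneg A).trans hAK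
  have hdisc : ∀ᵐ ω ∂μ, ∀ q : ℕ, ∀ᶠ n : ℕ in atTop, ∀ k ≤ n,
      discrepancy (j n) (k / n) ((finPrefix n k).map (σ n ω).toEmbedding)
        ≤ ((q : ℝ) + 1)⁻¹ * n :=
    ae_all_iff.mpr fun q => ae_eventually_discrepancy_le
      (fun ε hε => eventually_natCast_le_mul_of_isLittleO hc hε) j hσ (by positivity)
      (inv_le_one_of_one_le₀ (by linarith [(Nat.cast_nonneg q : (0 : ℝ) ≤ q)]))
  filter_upwards [hdisc] with ω hω
  rw [Metric.tendstoUniformlyOn_iff]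
  intro η hη
  set Φ : ℝ × ℝ → ℝ := fun z =>
    (‖(1 : M)‖ * Real.exp K * z.1
        + 2 * ‖(1 : M)‖ ^ 2 * K * Real.exp K * Real.exp K * (z.2 * K + z.1))
      + ‖(1 : M)‖ * Real.exp ‖A‖ * (z.2 * ‖A‖ * Real.exp (z.2 * ‖A‖)) with hΦ
  have hΦc : Tendsto Φ (𝓝 (0, 0)) (𝓝 0) := by
    have : Continuous Φ := by fun_prop
    simpa [hΦ] using this.tendsto (0, 0)
  obtain ⟨ρ, hρ, hball⟩ := Metric.eventually_nhds_iff.mp (hΦc.eventually_lt_const hη)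
  obtain ⟨q, hq⟩ := exists_nat_one_div_lt (show 0 < ρ / (4 * (K + 1)) by positivity)
  have h1 : ∀ᶠ n : ℕ in atTop, ‖(n : ℝ)⁻¹ • ∑ i, a n i - A‖ < ρ / 4 :=
    (tendsto_iff_norm_sub_tendsto_zero.mp ha_avg).eventually_lt_const (by positivity)
  have h2 : ∀ᶠ n : ℕ in atTop, (n : ℝ)⁻¹ * ∑ i, ‖a n i - b n (j n i)‖ < ρ / 8 :=
    hb.eventually_lt_const (by positivity)
  have h3 : ∀ᶠ n : ℕ in atTop, (n : ℝ)⁻¹ < ρ :=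
    tendsto_inv_atTop_nhds_zero_nat.eventually_lt_const hρ
  filter_upwards [h1, h2, h3, hω q, eventually_gt_atTop 0] with n h1 h2 h3 h4 hn t ht
  have hn' : (0 : ℝ) < n := by exact_mod_cast hn
  have hε : ∀ k ≤ n, ‖∑ i ∈ finPrefix n k, ((n : ℝ)⁻¹ • a n (σ n ω i) - (n : ℝ)⁻¹ • A)‖
      ≤ 3 * ρ / 4 := fun k hk => by
    refine (norm_sum_finPrefix_sub_le hK0 hk (a n) (haK n) A (b n) (j n) (σ n ω)).trans ?_
    have h5 : (n : ℝ)⁻¹ *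
        discrepancy (j n) (k / n) ((finPrefix n k).map (σ n ω).toEmbedding) ≤ ρ / (4 * (K + 1)) := by
      rw [inv_mul_le_iff₀ hn', mul_comm]
      refine (h4 k hk).trans (mul_le_mul_of_nonneg_right ?_ hn'.le)
      rw [← one_div]; exact hq.le
    have h6 : K * (ρ / (4 * (K + 1))) ≤ ρ / 4 := by
      rw [← mul_div_assoc, div_le_div_iff₀ (by positivity) (by norm_num)]
      nlinarith
    linarith [mul_le_mul_of_nonneg_left h5 hK0]
  rw [dist_eq_norm]
  refine (norm_exp_smul_sub_permutedExpProd_le hn (a n) (haK n) hAK (σ n ω) hε ht.1 ht.2).trans_lt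
    (hball (y := (3 * ρ / 4, (n : ℝ)⁻¹)) ?_)
  rw [Prod.dist_eq, max_lt_iff, Real.dist_eq, Real.dist_eq, sub_zero, sub_zero,
    abs_of_nonneg (by positivity), abs_of_nonneg (by positivity)]
  exact ⟨by linarith, h3⟩
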